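/- Fix a horizon $T\ge 0$ and a probability space $(\Omega,\mathcal A,\mathbb P)$ with a filtration $\mathcal F=(\mathcal F_t)_{t\in[0,T]}$. Let $U=(U_t)_{t\in[0,T]}$ be an $\mathcal F$-adapted càdlàg continuous-time Markov chain with generator $L$ and finite state space $\{\theta^1,\dots,\theta^J\}\subset\mathbb R$ (distinct $\theta^j$). Let $\varphi,\psi\ge 0$ and $\gamma,\sigma,\mathfrak q,\mathcal S^-,\mathcal S^+\in\mathbb R$, and put $$\lambda^{a,j}=\varphi+\psi\,e^{-\gamma\,\max(\mathfrak q\sigma\theta^j,\,\mathcal S^-)},\qquad \lambda^{b,j}=\varphi+\psi\,e^{\gamma\,\min(\mathfrak q\sigma\theta^j,\,\mathcal S^+)},\qquad j=1,\dots,J.$$ A process $N$ is said to be a counting process with stochastic intensity $\lambda$ with respect to a filtration $\mathcal G$ if: $N$ is $\mathcal G$-adapted and its paths are $\mathbb N$-valued, nondecreasing and right-continuous, start at $0$ and have jumps of size one; $\lambda$ is $\mathcal G$-progressively measurable, with $\lambda_t\ge 0$ a.s. for every $t$ and $\int_0^T\lambda_s\,ds<\infty$ a.s.; and for every nonnegative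 $\mathcal G$-predictable process $C$, $$\mathbb E\Big[\int_{(0,T]}C_s\,dN_s\Big]=\mathbb E\Big[\int_0^T C_s\lambda_s\,ds\Big].$$ Let the market arrival processes $M^a$ and $M^b$ be counting processes with stochastic intensities, with respect to $\mathcal F$, $$\lambda^a_t=\sum_{j=1}^J\lambda^{a,j}\mathbf 1_{\{U_t=\theta^j\}},\qquad \lambda^b_t=\sum_{j=1}^J\lambda^{b,j}\mathbf 1_{\{U_t=\theta^j\}},$$ respectively. Let $\mathcal F^M_t=\sigma(M^a_s,M^b_s:\,s\le t)$, $t\in[0,T]$. Then there exist $\mathcal F^M$-progressively measurable processes $\pi^1,\dots,\pi^J$ such that $\pi^j_t=\mathbb E[\mathbf 1_{\{U_t=\theta^j\}}\mid\mathcal F^M_t]$ a.s. for all $t\in[0,T]$ and all $j$. Moreover, for every such choice of $\pi^1,\dots,\pi^J$, the process $M^a$ is a counting process with stochastic intensity $\hat\lambda^a_t=\sum_{j=1}^J\lambda^{a,j}\pi^j_t$ with respect to $\mathcal F^M$, and $M^b$ is a counting process with stochastic intensity $\hat\lambda^b_t=\sum_{j=1}^J\lambda^{b,j}\pi^j_t$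 with respect to $\mathcal F^M$; and the processes $$M^a_t-\int_0^t\hat\lambda^a_s\,ds,\qquad M^b_t-\int_0^t\hat\lambda^b_s\,ds,\qquad t\in[0,T],$$ are $\mathcal F^M$-martingales. -/

import Mathlib

open MeasureTheory ProbabilityTheory Filter Topology Set
open scoped NNReal ENNReal

namespace FadModel

/-- The finite time horizon `[0, T]`. Lebesgue measure on it is `volume`. -/
abbrev Horizon (T : ℝ≥0) : Type := Set.Icc (0 : ℝ) (T : ℝ)

instance instOrderBotHorizon (T : ℝ≥0) : OrderBot (Horizon T) where
  bot := ⟨0, le_rfl, T.2⟩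
  bot_le t := t.2.1

noncomputable instance instMeasureSpaceHorizon (T : ℝ≥0) : MeasureSpace (Horizon T) :=
  Measure.Subtype.measureSpace

variable {Ω : Type*} {mΩ : MeasurableSpace Ω} {T : ℝ≥0} {J : ℕ}

/-- A counting path on `[0, T]`: a right-continuous nondecreasing `ℕ`-valued function that starts
at `0` and has jumps of size one. (Left limits exist automatically for such a function.) -/
structure IsCountingPath (f : Horizon T → ℕ) : Prop where
  zero : f ⊥ = 0
  mono : Monotone f
  rightCts : ∀ t, ContinuousWithinAt f (Ici t) t
  jump : ∀ t, f t ≤ Function.leftLim f t + 1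

/-- The jump times `{t : f (t-) ≠ f t}` of a path. (At time `0`, `f (0-) = f 0` by convention.) -/
def jumpTimes (f : Horizon T → ℕ) : Set (Horizon T) :=
  {t | Function.leftLim f t ≠ f t}

/-- The counting process `N` has the stochastic intensity `lam` with respect to the filtration
`𝓕`: the path of `N` is a counting path, `N` is `𝓕`-adapted, `lam` is `𝓕`-progressive,
nonnegative and pathwise integrable on `[0, T]`, and for every nonnegative `𝓕`-predictable
process `C`, `E[∫_(0,T] C_s dN_s] = E[∫_0^T C_s lam_s ds]`. The integral of `C` against `N` is the
sum of the values of `C` at the jump times of `N`. -/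
structure HasStochasticIntensity (P : Measure Ω) (𝓕 : Filtration (Horizon T) mΩ)
    (N : Horizon T → Ω → ℕ) (lam : Horizon T → Ω → ℝ) : Prop where
  countingPath : ∀ ω, IsCountingPath (fun t => N t ω)
  adapted : Adapted 𝓕 N
  progressive : IsProgressive 𝓕 lam
  nonneg : ∀ t, 0 ≤ᵐ[P] lam t
  integrable : ∀ᵐ ω ∂P, Integrable (fun s => lam s ω) volume
  lintegral_eq : ∀ C : Horizon T → Ω → ℝ≥0∞,
    Measurable[𝓕.predictable] (fun p : Horizon T × Ω => C p.1 p.2) →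
      ∫⁻ ω, ∑' s : jumpTimes (fun t => N t ω), C s ω ∂P
        = ∫⁻ ω, (∫⁻ s, C s ω * ENNReal.ofReal (lam s ω) ∂volume) ∂P

/-- `U` is a continuous-time Markov chain on the state space `{θ 0, …, θ (J - 1)}` (distinct real
numbers) with generator `L`: it has càdlàg paths in the state space, `L` is a generator matrix
(nonnegative off-diagonal entries, zero row sums), and conditionally on its past up to time `s`
the law of `U t` is row `U s` of `exp ((t - s) L)`. -/
structure IsMarkovChain (P : Measure Ω) (θ : Fin J → ℝ) (L : Matrix (Fin J) (Fin J) ℝ)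
    (U : Horizon T → Ω → ℝ) : Prop where
  injective : Function.Injective θ
  offDiag_nonneg : ∀ i j, i ≠ j → 0 ≤ L i j
  row_sum : ∀ i, ∑ j, L i j = 0
  measurable : ∀ t, Measurable (U t)
  mem_range : ∀ t ω, U t ω ∈ Set.range θ
  rightCts : ∀ ω t, ContinuousWithinAt (fun s => U s ω) (Ici t) t
  leftLim : ∀ ω t, ∃ l, Tendsto (fun s => U s ω) (𝓝[<] t) (𝓝 l)
  markov : ∀ s t, s ≤ t → ∀ j,
    P[{ω | U t ω = θ j}.indicator (fun _ => (1 : ℝ)) |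
        Filtration.natural U (fun r => (measurable r).stronglyMeasurable) s]
      =ᵐ[P] fun ω => ∑ i, {ω | U s ω = θ i}.indicator (fun _ => (1 : ℝ)) ω
        * NormedSpace.exp (((t : ℝ) - (s : ℝ)) • L) i j

/-- The ask-side arrival rate `φ + ψ exp (-γ ((𝔮 σ x) ∨ S⁻))` when the fad equals `x`. -/
noncomputable def askRate (φ ψ γ σ 𝔮 Sm x : ℝ) : ℝ :=
  φ + ψ * Real.exp (-γ * max (𝔮 * σ * x) Sm)

/-- The bid-side arrival rate `φ + ψ exp (γ ((𝔮 σ x) ∧ S⁺))` when the fad equals `x`. -/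
noncomputable def bidRate (φ ψ γ σ 𝔮 Sp x : ℝ) : ℝ :=
  φ + ψ * Real.exp (γ * min (𝔮 * σ * x) Sp)

/-- The modulated intensity `λ_t = ∑ j, r j 1_{U_t = θ j}`, where `r j` is the rate in state
`θ j`. -/
noncomputable def modulatedIntensity (θ : Fin J → ℝ) (U : Horizon T → Ω → ℝ) (r : Fin J → ℝ) :
    Horizon T → Ω → ℝ :=
  fun t ω => ∑ j, r j * {ω | U t ω = θ j}.indicator (fun _ => (1 : ℝ)) ω

/-- The filtration `𝓕ᴹ` generated by the pair of arrival processes `(Mᵃ, Mᵇ)`. -/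
def arrivalFiltration (Ma Mb : Horizon T → Ω → ℕ) (ha : ∀ t, Measurable (Ma t))
    (hb : ∀ t, Measurable (Mb t)) : Filtration (Horizon T) mΩ :=
  Filtration.natural (fun t ω => (Ma t ω, Mb t ω))
    (fun t => ((ha t).prodMk (hb t)).stronglyMeasurable)

/-- `π` is a version of the filter of `U` given `𝓖`: for each `j`, `π j` is a `𝓖`-progressive
process with `π j t = E[1_{U_t = θ j} | 𝓖 t]` almost surely for every `t`. (Conditional
expectations at single times determine `π j t` only up to null sets; progressive measurability is
what gives a meaning to the time integral of `π j`.) -/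
structure IsFilter (P : Measure Ω) (𝓖 : Filtration (Horizon T) mΩ) (θ : Fin J → ℝ)
    (U : Horizon T → Ω → ℝ) (π : Fin J → Horizon T → Ω → ℝ) : Prop where
  progressive : ∀ j, IsProgressive 𝓖 (π j)
  eq_condExp : ∀ j t,
    π j t =ᵐ[P] P[{ω | U t ω = θ j}.indicator (fun _ => (1 : ℝ)) | 𝓖 t]

/-- The filtered intensity `∑ j, r j π^j_t`. -/
def filteredIntensity (π : Fin J → Horizon T → Ω → ℝ) (r : Fin J → ℝ) : Horizon T → Ω → ℝ :=
  fun t ω => ∑ j, r j * π j t ω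

/-- The compensated process `N_t - ∫_0^t lam_s ds`. -/
noncomputable def compensated (N : Horizon T → Ω → ℕ) (lam : Horizon T → Ω → ℝ) :
    Horizon T → Ω → ℝ :=
  fun t ω => (N t ω : ℝ) - ∫ s in Iic t, lam s ω

end FadModel

/-!
The existence of the filter comes down to a measurable choice, in the time variable, of versions of
the conditional expectations `E[1_{U_t = θ j} | 𝓕ᴹ_t]`. Since the paths of `(Mᵃ, Mᵇ)` are
right-continuous, `𝓕ᴹ_t` is generated by one random variable `Y_t` with values in `ℕ → ℕ × ℕ`, which
lists the values of the arrival processes at time `t` and at the times `min d t`, for `d` in a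
countable dense set of times; and `Y` is a progressive process (`natural_eq_comap`). The joint law of
`(Y_t, U_t)` is a kernel in `t`. Its disintegration over the first coordinate is a kernel jointly
measurable in `(t, y)`, and evaluating it at `(t, Y_t)` gives a progressive process which, for every
`t`, is a version of the conditional expectation (`exists_progressive_condExp`). This needs neither
completeness nor right-continuity of the filtration.

For the change of filtration, let `C` be nonnegative and `𝓕ᴹ`-predictable. It is also
`𝓕`-predictable, so `E[∑ C_s ΔN_s] = E[∫ C_s λ_s ds]`. By Tonelli's theorem the right-hand side is
`∫ E[C_s λ_s] ds`, and as `C_s` is `𝓕ᴹ_s`-measurable, `λ_s` may be replaced by its conditional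
expectation given `𝓕ᴹ_s` at each time `s` (`HasStochasticIntensity.of_condExp`). Conditional
expectations of the modulated intensity are the filtered intensity by linearity.

Finally, a counting process compensated by an integrable intensity is a martingale
(`HasStochasticIntensity.martingale_compensated`): for `A ∈ 𝓖_s`, the process
`C = 1_{(s, t] × A}` is predictable, and the sum of its values at the jump times of `N` is
`1_A (N_t - N_s)`, because a counting path has exactly `N_t - N_s` jump times in `(s, t]`
(`IsCountingPath.tsum_jumpTimes_Ioc`).
-/

namespace FadModel

variable {Ω : Type*} {mΩ : MeasurableSpace Ω} {T : ℝ≥0} {J : ℕ}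

/-! ### Jump times of counting paths -/

/-- A counting path skips no level between `f s` and `f t`: the first time at which it reaches `k` is
a jump time, and `f` equals `k` there since jumps have size one. -/
theorem IsCountingPath.exists_jump {f : Horizon T → ℕ} (hf : IsCountingPath f)
    {s t : Horizon T} {k : ℕ} (hs : f s < k) (ht : k ≤ f t) :
    ∃ r ∈ Ioc s t, r ∈ jumpTimes f ∧ f r = k := by
  let S : Set ℝ := {x | ∃ h : x ∈ Icc (0 : ℝ) T, k ≤ f ⟨x, h⟩}
  have hSne : S.Nonempty := ⟨t, t.2, ht⟩
  have hlb : ∀ x ∈ S, (s : ℝ) < x := by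
    rintro x ⟨hx, hk⟩
    by_contra! h
    exact absurd (hs.trans_le hk) (not_lt.2 (hf.mono (show (⟨x, hx⟩ : Horizon T) ≤ s from h)))
  have hbdd : BddBelow S := ⟨s, fun x hx => (hlb x hx).le⟩
  have hsr : (s : ℝ) ≤ sInf S := le_csInf hSne fun x hx => (hlb x hx).le
  have hrt : sInf S ≤ t := csInf_le hbdd ⟨t.2, ht⟩
  let r : Horizon T := ⟨sInf S, s.2.1.trans hsr, hrt.trans t.2.2⟩
  -- right-continuity puts the infimum itself into the superlevel set
  have hkr : k ≤ f r := by
    have hev : ∀ᶠ u in 𝓝[≥] r, f u = f r :=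
      (hf.rightCts r).eventually (by simp : ∀ᶠ y in 𝓝 (f r), y = f r)
    obtain ⟨V, hV, hVr⟩ := mem_nhdsWithin_iff_exists_mem_nhds_inter.1 hev
    obtain ⟨ε, hε, hball⟩ := Metric.mem_nhds_iff.1 hV
    obtain ⟨x, ⟨hx, hkx⟩, hxlt⟩ := exists_lt_of_csInf_lt hSne (lt_add_of_pos_right (sInf S) hε)
    have hrx : sInf S ≤ x := csInf_le hbdd ⟨hx, hkx⟩
    have : f ⟨x, hx⟩ = f r := by
      apply hVr
      refine ⟨hball ?_, hrx⟩
      rw [Metric.mem_ball, Subtype.dist_eq, Real.dist_eq, abs_of_nonneg (sub_nonneg.2 hrx)]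
      change x - sInf S < ε
      linarith
    exact this ▸ hkx
  have hslt : s < r := by
    refine lt_of_le_of_ne hsr fun h => ?_
    rw [h] at hs
    exact absurd hs (not_lt.2 hkr)
  have hleft : ∀ u < r, f u < k := fun u hu => by
    by_contra! h
    exact absurd (csInf_le hbdd (show (u : ℝ) ∈ S from ⟨u.2, h⟩)) (not_le.2 hu)
  -- `ℕ` is discrete, so the left limit at `r` is a value that `f` takes just before `r`
  have hlim : Function.leftLim f r < k := by
    have hne : (𝓝[<] r).NeBot := nhdsLT_neBot_of_exists_lt ⟨s, hslt⟩
    have h2 := hf.mono.tendsto_leftLim r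
    have h3 : ∀ᶠ u in 𝓝[<] r, f u = Function.leftLim f r :=
      h2.eventually (by simp : ∀ᶠ y in 𝓝 (Function.leftLim f r), y = Function.leftLim f r)
    obtain ⟨u, hu, hur⟩ := (h3.and self_mem_nhdsWithin).exists
    exact hu ▸ hleft u hur
  have hj := hf.jump r
  exact ⟨r, ⟨hslt, hrt⟩, (hlim.trans_le hkr).ne, by omega⟩

theorem IsCountingPath.lt_of_mem_jumpTimes {f : Horizon T → ℕ} (hf : IsCountingPath f)
    {s r : Horizon T} (hr : r ∈ jumpTimes f) (h : s < r) : f s < f r :=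
  (hf.mono.le_leftLim h).trans_lt (lt_of_le_of_ne (hf.mono.leftLim_le le_rfl) hr)

/-- A counting path has `f t - f s` jump times in `(s, t]`: evaluation of `f` is a bijection from
them onto the integers in `(f s, f t]`. -/
theorem IsCountingPath.tsum_jumpTimes_Ioc {f : Horizon T → ℕ} (hf : IsCountingPath f)
    (s t : Horizon T) :
    ∑' r : jumpTimes f, (Ioc s t).indicator (fun _ => (1 : ℝ≥0∞)) r = (f t - f s : ℕ) := by
  have himg : f '' (jumpTimes f ∩ Ioc s t) = Finset.Ioc (f s) (f t) := by
    ext k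
    simp only [mem_image, mem_inter_iff, Finset.coe_Ioc]
    constructor
    · rintro ⟨r, ⟨hr, hsr, hrt⟩, rfl⟩
      exact ⟨hf.lt_of_mem_jumpTimes hr hsr, hf.mono hrt⟩
    · rintro ⟨h1, h2⟩
      obtain ⟨r, hr, hj, hk⟩ := hf.exists_jump h1 h2
      exact ⟨r, ⟨hj, hr⟩, hk⟩
  have hinj : InjOn f (jumpTimes f ∩ Ioc s t) := by
    intro a ha b hb hab
    rcases lt_trichotomy a b with h | h | h
    · exact absurd hab (hf.lt_of_mem_jumpTimes hb.1 h).ne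
    · exact h
    · exact absurd hab (hf.lt_of_mem_jumpTimes ha.1 h).ne'
  rw [tsum_subtype (jumpTimes f) ((Ioc s t).indicator fun _ => (1 : ℝ≥0∞)), indicator_indicator,
    ← tsum_subtype, ENNReal.tsum_set_const, mul_one, ← hinj.encard_image, himg,
    Set.encard_coe_eq_coe_finsetCard, Nat.card_Ioc]
  rfl

/-! ### Right-continuous adapted processes are progressive -/

/-- Times in `[0, i]` can be approximated from the right, from within `[0, i]`, by measurable maps
with countably many values. The values stay below `i`, which is what progressive measurability of a
right-continuous process requires. -/
theorem exists_rightApprox (i : Horizon T) :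
    ∃ (h : ℕ → ℕ → Horizon T) (k : ℕ → Horizon T → ℕ), (∀ n, Measurable (k n)) ∧
      (∀ n j, h n j ≤ i) ∧
      ∀ s ≤ i, Tendsto (fun n => h n (k n s)) atTop (𝓝[≥] s) := by
  -- the next multiple of `1 / (n + 1)` after `s`, truncated at `i`
  let h : ℕ → ℕ → Horizon T :=
    fun n k => min i (projIcc 0 (T : ℝ) T.coe_nonneg ((k + 1) / (n + 1)))
  let k : ℕ → Horizon T → ℕ := fun n s => ⌊((n : ℝ) + 1) * s⌋₊
  have hk : ∀ n, Measurable (k n) := fun n =>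
    Nat.measurable_floor.comp (measurable_subtype_coe.const_mul _)
  have hlow : ∀ n (s : Horizon T), s ≤ i → s ≤ h n (k n s) := by
    intro n s hs
    refine le_min hs ?_
    refine (projIcc_val T.coe_nonneg s).symm.le.trans (monotone_projIcc _ ?_)
    rw [le_div_iff₀ (by positivity), mul_comm]
    exact (Nat.lt_floor_add_one _).le
  have hupp : ∀ n (s : Horizon T), s ≤ i → (h n (k n s) : ℝ) ≤ s + 1 / (n + 1) := by
    intro n s hs
    have h0 : (0 : ℝ) ≤ (k n s + 1) / (n + 1) := by positivity
    have h1 : (h n (k n s) : ℝ) ≤ (k n s + 1) / (n + 1) := by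
      refine (show (h n (k n s) : ℝ) ≤
        (projIcc 0 (T : ℝ) T.coe_nonneg ((k n s + 1) / (n + 1)) : ℝ) from min_le_right _ _).trans ?_
      rw [coe_projIcc]
      exact max_le h0 (min_le_right _ _)
    refine h1.trans ?_
    rw [add_div]
    gcongr
    rw [div_le_iff₀ (by positivity), mul_comm]
    exact Nat.floor_le (mul_nonneg (by positivity) s.2.1)
  refine ⟨h, k, hk, fun n j => min_le_left _ _, fun s hs =>
    tendsto_nhdsWithin_iff.2 ⟨?_, Eventually.of_forall fun n => hlow n s hs⟩⟩
  rw [tendsto_subtype_rng]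
  refine tendsto_of_tendsto_of_tendsto_of_le_of_le tendsto_const_nhds ?_
    (fun n => hlow n s hs) (fun n => hupp n s hs)
  simpa using tendsto_const_nhds.add (tendsto_one_div_add_atTop_nhds_zero_nat (𝕜 := ℝ))

theorem measurable_natIndex {α β : Type*} [MeasurableSpace α] [MeasurableSpace β] {k : α → ℕ}
    (hk : Measurable k) {F : ℕ → Ω → β} (hF : ∀ j, Measurable (F j)) :
    Measurable fun p : α × Ω => F (k p.1) p.2 :=
  (measurable_from_prod_countable_right (f := fun q : ℕ × Ω => F q.1 q.2) hF).comp
    ((hk.comp measurable_fst).prodMk measurable_snd)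

theorem isProgressive_of_rightCts {β : Type*} [TopologicalSpace β]
    [TopologicalSpace.PseudoMetrizableSpace β] [MeasurableSpace β] [BorelSpace β]
    {𝓕 : Filtration (Horizon T) mΩ} {X : Horizon T → Ω → β} (hX : Adapted 𝓕 X)
    (hr : ∀ ω t, ContinuousWithinAt (fun s => X s ω) (Ici t) t) : IsProgressive 𝓕 X := by
  intro i
  obtain ⟨h, k, hk, hle, hlim⟩ := exists_rightApprox i
  refine @measurable_of_tendsto_metrizable (Iic i × Ω) β
    (Subtype.instMeasurableSpace.prod (𝓕 i)) _ _ _ _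
    (fun n p => X (h n (k n p.1)) p.2) _ (fun n => ?_) ?_
  · exact measurable_natIndex (mΩ := 𝓕 i) (F := fun j => X (h n j))
      ((hk n).comp measurable_subtype_coe)
      fun j => (hX (h n j)).mono (𝓕.mono (hle n j)) le_rfl
  · rw [tendsto_pi_nhds]
    exact fun p => (hr p.2 p.1).tendsto.comp (hlim p.1 p.1.2)

theorem measurable_uncurry_of_isProgressive {β : Type*} [MeasurableSpace β]
    {𝓕 : Filtration (Horizon T) mΩ} {X : Horizon T → Ω → β} (hX : IsProgressive 𝓕 X) :
    Measurable (Function.uncurry X) := by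
  let e : Horizon T := ⟨T, T.2, le_rfl⟩
  have h1 := (hX e).mono (sup_le_sup le_rfl (MeasurableSpace.comap_mono (𝓕.le e))) le_rfl
  have h2 : Measurable (fun p : Horizon T × Ω => ((⟨p.1, p.1.2.2⟩ : Iic e), p.2)) :=
    (measurable_fst.subtype_mk).prodMk measurable_snd
  exact h1.comp h2

/-! ### A progressive version of conditional expectations -/

/-- If `𝓖 t` is generated by `Y t` for a progressive process `Y`, and `X` is jointly measurable, then
the conditional probabilities of `{X t ∈ S}` given `𝓖 t` have a progressive version. The version is
`κ (t, Y t) S`, where `κ` disintegrates the joint laws of `(Y t, X t)` measurably in `t`. -/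
theorem exists_progressive_condExp {P : Measure Ω} [IsProbabilityMeasure P]
    {𝓖 : Filtration (Horizon T) mΩ} {E B : Type*} [MeasurableSpace E]
    [MeasurableSpace.CountablyGenerated E] [MeasurableSpace B] [StandardBorelSpace B] [Nonempty B]
    {Y : Horizon T → Ω → E} (hY : IsProgressive 𝓖 Y)
    (h𝓖 : ∀ t, 𝓖 t = MeasurableSpace.comap (Y t) inferInstance)
    {X : Horizon T → Ω → B} (hX : Measurable (Function.uncurry X)) {S : Set B}
    (hS : MeasurableSet S) :
    ∃ p : Horizon T → Ω → ℝ, IsProgressive 𝓖 p ∧ ∀ t, p t =ᵐ[P] P⟦X t ⁻¹' S | 𝓖 t⟧ := by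
  have hYm : Measurable (Function.uncurry Y) := measurable_uncurry_of_isProgressive hY
  have hYt : ∀ t, Measurable (Y t) := fun t => hYm.comp measurable_prodMk_left
  have hXt : ∀ t, Measurable (X t) := fun t => hX.comp measurable_prodMk_left
  have hYX : Measurable fun q : Horizon T × Ω => (Y q.1 q.2, X q.1 q.2) := hYm.prodMk hX
  -- the joint law of `(Y t, X t)`, as a kernel in `t`
  let κ : Kernel (Horizon T) (E × B) :=
    (Kernel.id ×ₖ Kernel.const (Horizon T) P).map fun q => (Y q.1 q.2, X q.1 q.2)
  have hκm : IsMarkovKernel κ := Kernel.IsMarkovKernel.map _ hYX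
  have hκ : ∀ t, κ t = P.map fun ω => (Y t ω, X t ω) := by
    intro t
    rw [Kernel.map_apply _ hYX, Kernel.prod_apply, Kernel.id_apply, Kernel.const_apply,
      Measure.dirac_prod, Measure.map_map hYX measurable_prodMk_left]
    rfl
  have hmeas : Measurable fun q : Horizon T × E => (κ.condKernel q).real S :=
    (Kernel.measurable_coe _ hS).ennreal_toReal
  refine ⟨fun t ω => (κ.condKernel (t, Y t ω)).real S, fun i => ?_, fun t => ?_⟩
  · exact hmeas.comp ((measurable_subtype_coe.comp measurable_fst).prodMk (hY i))
  · have hc : P.map (fun ω => (Y t ω, X t ω)) =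
        P.map (Y t) ⊗ₘ (κ.condKernel.comap (fun y => (t, y)) measurable_prodMk_left) := by
      have h1 := κ.disintegrate κ.condKernel
      have h2 : P.map (Y t) = κ.fst t := by
        rw [Kernel.fst_apply, hκ, Measure.map_map measurable_fst ((hYt t).prodMk (hXt t))]
        rfl
      rw [h2, ← hκ t]
      conv_lhs => rw [← h1]
      exact Kernel.compProd_apply_eq_compProd_sectR _ _ _
    have h3 := condDistrib_ae_eq_of_measure_eq_compProd_of_measurable (hYt t) (hXt t) hc
    have h4 := condDistrib_ae_eq_condExp (μ := P) (hYt t) (hXt t) hS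
    rw [h𝓖 t]
    refine EventuallyEq.trans ?_ h4
    filter_upwards [ae_of_ae_map (hYt t).aemeasurable h3] with ω hω
    rw [hω]
    rfl

/-- The natural filtration of a right-continuous process is generated, at each time, by a single
random variable with values in a countable product, and these variables form a progressive process. -/
theorem natural_eq_comap {E : Type*} [TopologicalSpace E] [TopologicalSpace.MetrizableSpace E]
    [MeasurableSpace E] [BorelSpace E] {N : Horizon T → Ω → E}
    (hN : ∀ t, StronglyMeasurable (N t))
    (hr : ∀ ω t, ContinuousWithinAt (fun s => N s ω) (Ici t) t) :
    ∃ Y : Horizon T → Ω → (ℕ → E), IsProgressive (Filtration.natural N hN) Y ∧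
      ∀ t, Filtration.natural N hN t = MeasurableSpace.comap (Y t) inferInstance := by
  have had : Adapted (Filtration.natural N hN) N :=
    (Filtration.stronglyAdapted_natural hN).adapted
  let d := TopologicalSpace.denseSeq (Horizon T)
  -- the value at `t` comes first: it is not a limit of values at times in `[0, t)`
  let Y : Horizon T → Ω → (ℕ → E) := fun t ω n => Nat.casesOn n (N t ω) fun m => N (min (d m) t) ω
  have hY0 : ∀ t ω, Y t ω 0 = N t ω := fun _ _ => rfl
  have hYs : ∀ t ω m, Y t ω (m + 1) = N (min (d m) t) ω := fun _ _ _ => rfl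
  refine ⟨Y, fun i => ?_, fun t => le_antisymm ?_ ?_⟩
  · refine @measurable_pi_lambda _ _ _ (Subtype.instMeasurableSpace.prod _) _ _ fun n => ?_
    cases n with
    | zero => exact isProgressive_of_rightCts had hr i
    | succ m =>
      refine isProgressive_of_rightCts (X := fun t ω => N (min (d m) t) ω)
        (fun t => had.measurable_le (min_le_right _ _)) (fun ω t => ?_) i
      refine (hr ω (min (d m) t)).comp (t := Ici (min (d m) t))
        (continuous_const.min continuous_id).continuousWithinAt ?_
      exact fun s hs => min_le_min (le_refl (d m)) hs
  · refine iSup₂_le fun s hs => ?_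
    rw [← measurable_iff_comap_le]
    have hYm : Measurable[MeasurableSpace.comap (Y t) inferInstance] (Y t) := comap_measurable _
    have hYn : ∀ n, Measurable[MeasurableSpace.comap (Y t) inferInstance] fun ω => Y t ω n :=
      fun n => (measurable_pi_apply n).comp hYm
    rcases hs.eq_or_lt with rfl | hs
    · exact hYn 0
    -- for `s < t`, the value at `s` is a limit of values at dense times in `(s, t)`, for which
    -- `min d t = d`
    have hne : (𝓝[Ioo s t ∩ range d] s).NeBot := by
      rw [← mem_closure_iff_nhdsWithin_neBot]
      have h1 := (TopologicalSpace.denseRange_denseSeq (Horizon T)).open_subset_closure_inter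
        (isOpen_Ioo (a := s) (b := t))
      refine closure_minimal h1 isClosed_closure ?_
      rw [closure_Ioo hs.ne]
      exact left_mem_Icc.2 hs.le
    obtain ⟨u, hu⟩ := exists_seq_tendsto (𝓝[Ioo s t ∩ range d] s)
    obtain ⟨hus, hum⟩ := tendsto_nhdsWithin_iff.1 hu
    obtain ⟨n₀, hn₀⟩ := eventually_atTop.1 hum
    have hmem : ∀ n, u (n + n₀) ∈ Ioo s t ∩ range d := fun n => hn₀ _ (Nat.le_add_left _ _)
    refine @measurable_of_tendsto_metrizable Ω E (MeasurableSpace.comap (Y t) inferInstance) _ _ _ _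
      (fun n => N (u (n + n₀))) _ (fun n => ?_) (tendsto_pi_nhds.2 fun ω => ?_)
    · obtain ⟨⟨-, hlt⟩, m, hm⟩ := hmem n
      have h2 : N (u (n + n₀)) = fun ω => Y t ω (m + 1) := by
        funext ω
        rw [hYs, hm, min_eq_left hlt.le]
      rw [h2]
      exact hYn (m + 1)
    · exact (hr ω s).tendsto.comp (tendsto_nhdsWithin_iff.2
        ⟨hus.comp (tendsto_add_atTop_nat n₀), Eventually.of_forall fun n => (hmem n).1.1.le⟩)
  · rw [← measurable_iff_comap_le]
    refine @measurable_pi_lambda _ _ _ (Filtration.natural N hN t) _ _ fun n => ?_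
    cases n with
    | zero => exact had t
    | succ m => exact had.measurable_le (min_le_right _ _)

/-! ### Conditional expectation and predictable processes -/

/-- A nonnegative random variable may be replaced by its conditional expectation when it is
integrated against a nonnegative `m`-measurable function: both densities define the same measure
on `m`. -/
theorem lintegral_mul_ofReal_condExp {P : Measure Ω} [IsFiniteMeasure P] {m : MeasurableSpace Ω}
    (hm : m ≤ mΩ) {X Z : Ω → ℝ} (hX : Integrable X P) (hX0 : 0 ≤ᵐ[P] X)
    (hZ : Z =ᵐ[P] P[X | m]) {C : Ω → ℝ≥0∞} (hC : Measurable[m] C) :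
    ∫⁻ ω, C ω * ENNReal.ofReal (X ω) ∂P = ∫⁻ ω, C ω * ENNReal.ofReal (Z ω) ∂P := by
  have hZi : Integrable Z P := integrable_condExp.congr hZ.symm
  have hZ0 : 0 ≤ᵐ[P] Z := by
    filter_upwards [hZ, condExp_nonneg (m := m) hX0] with ω h1 h2
    rwa [h1]
  have hwd : ∀ {W : Ω → ℝ}, Integrable W P → ∫⁻ ω, C ω * ENNReal.ofReal (W ω) ∂P =
      ∫⁻ ω, C ω ∂((P.withDensity fun ω => ENNReal.ofReal (W ω)).trim hm) := by
    intro W hW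
    rw [lintegral_trim hm hC, lintegral_withDensity_eq_lintegral_mul₀
      hW.1.aemeasurable.ennreal_ofReal (hC.mono hm le_rfl).aemeasurable]
    simp only [Pi.mul_apply, mul_comm]
  rw [hwd hX, hwd hZi]
  congr 1
  refine @Measure.ext _ m _ _ fun A hA => ?_
  rw [trim_measurableSet_eq hm hA, trim_measurableSet_eq hm hA, withDensity_apply _ (hm A hA),
    withDensity_apply _ (hm A hA), ← ofReal_integral_eq_lintegral_ofReal hX.integrableOn
    (ae_restrict_of_ae hX0), ← ofReal_integral_eq_lintegral_ofReal hZi.integrableOn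
    (ae_restrict_of_ae hZ0), ← setIntegral_condExp hm hX hA,
    setIntegral_congr_ae (hm A hA) (hZ.mono fun ω h _ => h)]

theorem measurable_of_predictable {𝓖 : Filtration (Horizon T) mΩ} {C : Horizon T → Ω → ℝ≥0∞}
    (hC : Measurable[𝓖.predictable] fun p : Horizon T × Ω => C p.1 p.2) :
    Measurable fun p : Horizon T × Ω => C p.1 p.2 :=
  hC.mono (measurableSpace_le_predictable_of_measurableSet
    (fun A hA => (measurableSet_singleton _).prod (𝓖.le _ A hA))
    (fun _ A hA => measurableSet_Ioi.prod (𝓖.le _ A hA))) le_rfl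

theorem adapted_of_predictable {𝓖 : Filtration (Horizon T) mΩ} {C : Horizon T → Ω → ℝ≥0∞}
    (hC : Measurable[𝓖.predictable] fun p : Horizon T × Ω => C p.1 p.2) (s : Horizon T) :
    Measurable[𝓖 s] (C s) := by
  have h1 : C s = (fun p : Iic s × Ω => C p.1 p.2) ∘ fun ω => (⟨s, mem_Iic.2 le_rfl⟩, ω) := rfl
  rw [h1]
  exact (hC.comp (measurable_inclusion_predictable (𝓕 := 𝓖) (i := s))).comp measurable_prodMk_left

theorem predictable_mono {𝓖 𝓕 : Filtration (Horizon T) mΩ} (h : 𝓖 ≤ 𝓕) :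
    𝓖.predictable ≤ 𝓕.predictable :=
  measurableSpace_le_predictable_of_measurableSet
    (fun A hA => measurableSet_predictable_singleton_bot_prod (h _ A hA))
    (fun _ A hA => measurableSet_predictable_Ioi_prod (h _ A hA))

instance instIsFiniteMeasureVolumeHorizon : IsFiniteMeasure (volume : Measure (Horizon T)) := by
  constructor
  rw [Measure.Subtype.volume_univ measurableSet_Icc.nullMeasurableSet]
  simp

/-! ### Change of filtration and the compensated martingale -/

section Projection

variable {P : Measure Ω} {𝓖 𝓕 : Filtration (Horizon T) mΩ}

/-- The innovation theorem: in a smaller filtration `𝓖` to which `N` is still adapted, a progressive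
version of the conditional expectations of the intensity given `𝓖` is again an intensity. -/
theorem HasStochasticIntensity.of_condExp [IsFiniteMeasure P] (h𝓖 : 𝓖 ≤ 𝓕) {N : Horizon T → Ω → ℕ}
    {lam lam' : Horizon T → Ω → ℝ} (hN : HasStochasticIntensity P 𝓕 N lam) (hN𝓖 : Adapted 𝓖 N)
    (hint : Integrable (Function.uncurry lam) ((volume : Measure (Horizon T)).prod P))
    (hlam' : IsProgressive 𝓖 lam') (hc : ∀ t, lam' t =ᵐ[P] P[lam t | 𝓖 t]) :
    HasStochasticIntensity P 𝓖 N lam' ∧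
      Integrable (Function.uncurry lam') ((volume : Measure (Horizon T)).prod P) := by
  have hm : Measurable (Function.uncurry lam) := measurable_uncurry_of_isProgressive hN.progressive
  have hm' : Measurable (Function.uncurry lam') := measurable_uncurry_of_isProgressive hlam'
  have hnn : ∀ t, 0 ≤ᵐ[P] lam' t := fun t => by
    filter_upwards [hc t, condExp_nonneg (m := 𝓖 t) (hN.nonneg t)] with ω h1 h2
    rwa [h1]
  have key : ∀ C : Horizon T → Ω → ℝ≥0∞,
      (Measurable[𝓖.predictable] fun p : Horizon T × Ω => C p.1 p.2) →
      ∫⁻ t, ∫⁻ ω, C t ω * ENNReal.ofReal (lam t ω) ∂P ∂volume =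
        ∫⁻ t, ∫⁻ ω, C t ω * ENNReal.ofReal (lam' t ω) ∂P ∂volume := by
    intro C hC
    refine lintegral_congr_ae ?_
    -- `lam t` is integrable for almost every `t` only, which is enough under the time integral
    filter_upwards [hint.prod_right_ae] with t ht
    exact lintegral_mul_ofReal_condExp (𝓖.le t) ht (hN.nonneg t) (hc t)
      (adapted_of_predictable hC t)
  have hint' : Integrable (Function.uncurry lam') ((volume : Measure (Horizon T)).prod P) := by
    refine ⟨hm'.aestronglyMeasurable, ?_⟩
    have h1 := key (fun _ _ => 1) measurable_const
    simp only [one_mul] at h1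
    have h2 : ∫⁻ p, ‖Function.uncurry lam' p‖ₑ ∂((volume : Measure (Horizon T)).prod P) =
        ∫⁻ t, ∫⁻ ω, ENNReal.ofReal (lam' t ω) ∂P ∂volume := by
      rw [lintegral_prod _ hm'.enorm.aemeasurable]
      refine lintegral_congr fun t => lintegral_congr_ae ?_
      filter_upwards [hnn t] with ω hω
      exact Real.enorm_eq_ofReal hω
    have h3 : ∫⁻ p, ‖Function.uncurry lam p‖ₑ ∂((volume : Measure (Horizon T)).prod P) =
        ∫⁻ t, ∫⁻ ω, ENNReal.ofReal (lam t ω) ∂P ∂volume := by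
      rw [lintegral_prod _ hm.enorm.aemeasurable]
      refine lintegral_congr fun t => lintegral_congr_ae ?_
      filter_upwards [hN.nonneg t] with ω hω
      exact Real.enorm_eq_ofReal hω
    rw [HasFiniteIntegral, h2, ← h1, ← h3]
    exact hint.2
  refine ⟨⟨hN.countingPath, hN𝓖, hlam', hnn, hint'.prod_left_ae, fun C hC => ?_⟩, hint'⟩
  have hCm := measurable_of_predictable hC
  rw [hN.lintegral_eq C (hC.mono (predictable_mono h𝓖) le_rfl),
    lintegral_lintegral_swap (f := fun ω s => C s ω * ENNReal.ofReal (lam s ω))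
      ((hCm.mul hm.ennreal_ofReal).comp measurable_swap).aemeasurable, key C hC,
    lintegral_lintegral_swap (f := fun ω s => C s ω * ENNReal.ofReal (lam' s ω))
      ((hCm.mul hm'.ennreal_ofReal).comp measurable_swap).aemeasurable]

/-- The defining identity of the intensity for the predictable process `1_{(s, t] × A}`. -/
theorem HasStochasticIntensity.setLIntegral_increment {N : Horizon T → Ω → ℕ}
    {lam : Horizon T → Ω → ℝ} (hN : HasStochasticIntensity P 𝓖 N lam) {s t : Horizon T}
    {A : Set Ω} (hA : MeasurableSet[𝓖 s] A) :
    ∫⁻ ω in A, (N t ω - N s ω : ℕ) ∂P =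
      ∫⁻ ω in A, ∫⁻ r in Ioc s t, ENNReal.ofReal (lam r ω) ∂volume ∂P := by
  have hA' := 𝓖.le s A hA
  let C : Horizon T → Ω → ℝ≥0∞ := fun r ω => A.indicator (fun _ => (Ioc s t).indicator 1 r) ω
  have hC : Measurable[𝓖.predictable] fun p : Horizon T × Ω => C p.1 p.2 := by
    have h1 : (fun p : Horizon T × Ω => C p.1 p.2) =
        (Ioc s t ×ˢ A).indicator fun _ => (1 : ℝ≥0∞) := by
      ext ⟨r, ω⟩
      by_cases h1 : r ∈ Ioc s t <;> by_cases h2 : ω ∈ A <;> simp [C, h1, h2]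
    rw [h1]
    exact measurable_const.indicator (measurableSet_predictable_Ioc_prod s t hA)
  have h := hN.lintegral_eq C hC
  rw [← lintegral_indicator hA', ← lintegral_indicator hA']
  convert h using 2
  · ext ω
    by_cases hω : ω ∈ A
    · simp only [C, indicator_of_mem hω]
      exact ((hN.countingPath ω).tsum_jumpTimes_Ioc s t).symm
    · simp [C, hω]
  · ext ω
    by_cases hω : ω ∈ A
    · simp only [C, indicator_of_mem hω]
      rw [← lintegral_indicator measurableSet_Ioc]
      refine lintegral_congr fun r => ?_
      by_cases hr : r ∈ Ioc s t <;> simp [hr]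
    · simp [C, hω]

/-- The compensated process is adapted without any completion of the filtration: the time integral up
to `t` only involves the intensity on `[0, t] × Ω`, which is measurable with respect to `𝓖 t`. -/
theorem HasStochasticIntensity.stronglyAdapted_compensated {N : Horizon T → Ω → ℕ}
    {lam : Horizon T → Ω → ℝ} (hN : HasStochasticIntensity P 𝓖 N lam) :
    StronglyAdapted 𝓖 (compensated N lam) := by
  intro t
  have h1 : StronglyMeasurable[𝓖 t] fun ω => (N t ω : ℝ) :=
    (measurable_from_top.comp (hN.adapted t)).stronglyMeasurable
  refine h1.sub ?_
  have h2 : (fun ω => ∫ s in Iic t, lam s ω) = fun ω =>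
      ∫ s : Iic t, lam s ω ∂(Measure.comap Subtype.val (volume : Measure (Horizon T))) := by
    ext ω
    exact (integral_subtype_comap measurableSet_Iic fun s => lam s ω).symm
  rw [h2]
  have : IsFiniteMeasure (Measure.comap (Subtype.val : Iic t → Horizon T) volume) := by
    constructor
    rw [comap_subtype_coe_apply measurableSet_Iic]
    exact measure_lt_top _ _
  exact @StronglyMeasurable.integral_prod_left' (Iic t) Ω ℝ _ (𝓖 t) _ _ _ _ _
    (hN.progressive t).stronglyMeasurable

theorem HasStochasticIntensity.martingale_compensated [IsFiniteMeasure P] {N : Horizon T → Ω → ℕ}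
    {lam : Horizon T → Ω → ℝ} (hN : HasStochasticIntensity P 𝓖 N lam)
    (hint : Integrable (Function.uncurry lam) ((volume : Measure (Horizon T)).prod P)) :
    Martingale (compensated N lam) 𝓖 P := by
  have hm : Measurable (Function.uncurry lam) := measurable_uncurry_of_isProgressive hN.progressive
  let Λ : Horizon T → Ω → ℝ := fun t ω => ∫ s in Iic t, lam s ω
  have hΛ : ∀ t, Integrable (Λ t) P := fun t => by
    have h1 := hint.restrict (s := Iic t ×ˢ univ)
    rw [← Measure.prod_restrict, Measure.restrict_univ] at h1
    exact h1.integral_prod_right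
  have hpath : ∀ᵐ ω ∂P, ∀ᵐ s ∂(volume : Measure (Horizon T)), 0 ≤ lam s ω :=
    (Measure.ae_ae_comm (p := fun s ω => 0 ≤ lam s ω) (measurableSet_le measurable_const hm)).1
      (Eventually.of_forall hN.nonneg)
  have hinc : ∀ s t, s ≤ t → ∀ᵐ ω ∂P, 0 ≤ Λ t ω - Λ s ω ∧
      ∫⁻ r in Ioc s t, ENNReal.ofReal (lam r ω) ∂volume = ENNReal.ofReal (Λ t ω - Λ s ω) := by
    intro s t hst
    filter_upwards [hpath, hN.integrable] with ω h0 hi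
    have h1 : Λ t ω - Λ s ω = ∫ r in Ioc s t, lam r ω := by
      rw [sub_eq_iff_eq_add, add_comm, ← setIntegral_union (Set.Iic_disjoint_Ioc le_rfl)
        measurableSet_Ioc hi.integrableOn hi.integrableOn, Iic_union_Ioc_eq_Iic hst]
    rw [h1]
    exact ⟨setIntegral_nonneg_of_ae h0, (ofReal_integral_eq_lintegral_ofReal hi.integrableOn
      (ae_restrict_of_ae h0)).symm⟩
  have hcast : ∀ s t, s ≤ t → ∀ ω, ((N t ω - N s ω : ℕ) : ℝ≥0∞) =
      ENNReal.ofReal ((N t ω : ℝ) - N s ω) := by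
    intro s t hst ω
    rw [← Nat.cast_sub ((hN.countingPath ω).mono hst), ENNReal.ofReal_natCast]
  have hNm : ∀ t, Measurable fun ω => (N t ω : ℝ) := fun t =>
    measurable_from_top.comp (hN.adapted.measurable (i := t))
  have hset : ∀ s t, s ≤ t → ∀ A, MeasurableSet[𝓖 s] A →
      ∫⁻ ω in A, ENNReal.ofReal ((N t ω : ℝ) - N s ω) ∂P =
        ∫⁻ ω in A, ENNReal.ofReal (Λ t ω - Λ s ω) ∂P := by
    intro s t hst A hA
    simp_rw [← hcast s t hst]
    rw [hN.setLIntegral_increment hA]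
    refine lintegral_congr_ae (ae_restrict_of_ae ?_)
    filter_upwards [hinc s t hst] with ω h using h.2
  have hNi : ∀ t, Integrable (fun ω => (N t ω : ℝ)) P := by
    intro t
    have h1 := hset ⊥ t bot_le univ MeasurableSet.univ
    simp only [Measure.restrict_univ] at h1
    refine ⟨(hNm t).aestronglyMeasurable, ?_⟩
    have h2 : ∀ ω, ‖(N t ω : ℝ)‖ₑ = ENNReal.ofReal ((N t ω : ℝ) - N ⊥ ω) := fun ω => by
      rw [(hN.countingPath ω).zero, Nat.cast_zero, sub_zero]
      exact Real.enorm_eq_ofReal (Nat.cast_nonneg _)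
    rw [HasFiniteIntegral, lintegral_congr h2, h1]
    exact ((hΛ t).sub (hΛ ⊥)).lintegral_lt_top
  have hci : ∀ t, Integrable (compensated N lam t) P := fun t => (hNi t).sub (hΛ t)
  have had := hN.stronglyAdapted_compensated
  refine ⟨had, fun s t hst => (ae_eq_condExp_of_forall_setIntegral_eq (𝓖.le s) (hci t)
    (fun _ _ _ => (hci s).integrableOn) (fun A hA _ => ?_) (had s).aestronglyMeasurable).symm⟩
  have h1 : ∫ ω in A, ((N t ω : ℝ) - N s ω) ∂P = ∫ ω in A, (Λ t ω - Λ s ω) ∂P := by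
    rw [integral_eq_lintegral_of_nonneg_ae (f := fun ω => (N t ω : ℝ) - N s ω) _
        ((hNm t).sub (hNm s)).aestronglyMeasurable,
      integral_eq_lintegral_of_nonneg_ae (f := fun ω => Λ t ω - Λ s ω) _
        ((hΛ t).sub (hΛ s)).1.restrict, hset s t hst A hA]
    · refine ae_restrict_of_ae ?_
      filter_upwards [hinc s t hst] with ω h using h.1
    · refine Eventually.of_forall fun ω => ?_
      exact sub_nonneg.2 (Nat.cast_le.2 ((hN.countingPath ω).mono hst))
  have hNsub : ∫ ω in A, ((N t ω : ℝ) - N s ω) ∂P =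
      ∫ ω in A, (N t ω : ℝ) ∂P - ∫ ω in A, (N s ω : ℝ) ∂P :=
    integral_sub (hNi t).integrableOn (hNi s).integrableOn
  have hΛsub : ∫ ω in A, (Λ t ω - Λ s ω) ∂P = ∫ ω in A, Λ t ω ∂P - ∫ ω in A, Λ s ω ∂P :=
    integral_sub (hΛ t).integrableOn (hΛ s).integrableOn
  have h2 : ∀ u, ∫ ω in A, compensated N lam u ω ∂P =
      ∫ ω in A, (N u ω : ℝ) ∂P - ∫ ω in A, Λ u ω ∂P := fun u =>
    integral_sub (hNi u).integrableOn (hΛ u).integrableOn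
  rw [h2, h2]
  linarith

end Projection

/-! ### Filtering a modulated intensity -/

section Modulated

variable {P : Measure Ω} [IsProbabilityMeasure P] {𝓖 𝓕 : Filtration (Horizon T) mΩ}
  {θ : Fin J → ℝ} {U : Horizon T → Ω → ℝ}

theorem integrable_modulatedIntensity (hU : Measurable (Function.uncurry U)) (r : Fin J → ℝ) :
    Integrable (Function.uncurry (modulatedIntensity θ U r))
      ((volume : Measure (Horizon T)).prod P) := by
  have h : Function.uncurry (modulatedIntensity θ U r) = fun p =>
      ∑ j, r j * (Function.uncurry U ⁻¹' {θ j}).indicator (fun _ => (1 : ℝ)) p := rfl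
  rw [h]
  refine integrable_finsetSum _ fun j _ => Integrable.const_mul ?_ (r j)
  exact (integrable_const (1 : ℝ)).indicator (hU (measurableSet_singleton (θ j)))

theorem filteredIntensity_ae_eq_condExp (hU : ∀ t, Measurable (U t))
    {π : Fin J → Horizon T → Ω → ℝ} (hπ : IsFilter P 𝓖 θ U π) (r : Fin J → ℝ) (t : Horizon T) :
    filteredIntensity π r t =ᵐ[P] P[modulatedIntensity θ U r t | 𝓖 t] := by
  have hi : ∀ j, Integrable ({ω | U t ω = θ j}.indicator fun _ => (1 : ℝ)) P := fun j =>
    (integrable_const 1).indicator (hU t (measurableSet_singleton (θ j)))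
  have h1 : modulatedIntensity θ U r t =
      ∑ j, r j • {ω | U t ω = θ j}.indicator fun _ => (1 : ℝ) := by
    ext ω
    simp [modulatedIntensity]
  have h2 := condExp_finsetSum (s := Finset.univ) (fun j _ => (hi j).smul (r j)) (𝓖 t)
  have h3 : ∀ᵐ ω ∂P, ∀ j, P[r j • {ω | U t ω = θ j}.indicator (fun _ => (1 : ℝ)) | 𝓖 t] ω =
      r j * π j t ω := by
    refine ae_all_iff.2 fun j => ?_
    filter_upwards [condExp_smul (μ := P) (r j) ({ω | U t ω = θ j}.indicator fun _ => (1 : ℝ))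
      (𝓖 t), hπ.eq_condExp j t] with ω h4 h5
    rw [h4, h5]
    rfl
  rw [h1]
  filter_upwards [h2, h3] with ω h4 h5
  rw [h4, Finset.sum_apply]
  exact Finset.sum_congr rfl fun j _ => (h5 j).symm

/-- The conclusion of the theorem for a single counting process `N` and an arbitrary filtration `𝓖 ≤ 𝓕`
to which `N` is adapted. -/
theorem HasStochasticIntensity.filteredIntensity (h𝓖 : 𝓖 ≤ 𝓕) (hU : Measurable (Function.uncurry U))
    {r : Fin J → ℝ} {N : Horizon T → Ω → ℕ}
    (hN : HasStochasticIntensity P 𝓕 N (modulatedIntensity θ U r)) (hN𝓖 : Adapted 𝓖 N)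
    {π : Fin J → Horizon T → Ω → ℝ} (hπ : IsFilter P 𝓖 θ U π) :
    HasStochasticIntensity P 𝓖 N (FadModel.filteredIntensity π r) ∧
      Martingale (compensated N (FadModel.filteredIntensity π r)) 𝓖 P := by
  have hprog : IsProgressive 𝓖 (FadModel.filteredIntensity π r) := fun i =>
    Finset.univ.measurable_sum fun j _ => (hπ.progressive j i).const_mul (r j)
  obtain ⟨h1, h2⟩ := hN.of_condExp h𝓖 hN𝓖 (integrable_modulatedIntensity hU r) hprog
    (filteredIntensity_ae_eq_condExp (fun t => hU.comp measurable_prodMk_left) hπ r)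
  exact ⟨h1, h1.martingale_compensated h2⟩

end Modulated

/-! ### The filtration of the arrival processes -/

theorem arrivalFiltration_le {𝓕 : Filtration (Horizon T) mΩ} {Ma Mb : Horizon T → Ω → ℕ}
    (ha : ∀ t, Measurable (Ma t)) (hb : ∀ t, Measurable (Mb t)) (haF : Adapted 𝓕 Ma)
    (hbF : Adapted 𝓕 Mb) : arrivalFiltration Ma Mb ha hb ≤ 𝓕 := fun _ =>
  iSup₂_le fun _ hs => measurable_iff_comap_le.1
    ((haF.measurable_le hs).prodMk (hbF.measurable_le hs))

theorem adapted_arrivalFiltration {Ma Mb : Horizon T → Ω → ℕ}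
    (ha : ∀ t, Measurable (Ma t)) (hb : ∀ t, Measurable (Mb t)) :
    Adapted (arrivalFiltration Ma Mb ha hb) fun t ω => (Ma t ω, Mb t ω) :=
  (Filtration.stronglyAdapted_natural fun t => ((ha t).prodMk (hb t)).stronglyMeasurable).adapted

theorem exists_isFilter {P : Measure Ω} [IsProbabilityMeasure P] {θ : Fin J → ℝ}
    {U : Horizon T → Ω → ℝ} (hU : Measurable (Function.uncurry U)) {Ma Mb : Horizon T → Ω → ℕ}
    (ha : ∀ t, Measurable (Ma t)) (hb : ∀ t, Measurable (Mb t))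
    (hac : ∀ ω, IsCountingPath fun t => Ma t ω) (hbc : ∀ ω, IsCountingPath fun t => Mb t ω) :
    ∃ π, IsFilter P (arrivalFiltration Ma Mb ha hb) θ U π := by
  obtain ⟨Y, hY, h𝓖⟩ := natural_eq_comap
    (fun t => ((ha t).prodMk (hb t)).stronglyMeasurable)
    fun ω t => ((hac ω).rightCts t).prodMk ((hbc ω).rightCts t)
  choose π hπ using fun j =>
    exists_progressive_condExp (P := P) hY h𝓖 hU (measurableSet_singleton (θ j))
  exact ⟨π, fun j => (hπ j).1, fun j t => (hπ j).2 t⟩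

end FadModel

theorem mainTheorem11 {Ω : Type*} {mΩ : MeasurableSpace Ω} (P : Measure Ω)
    [IsProbabilityMeasure P] (T : ℝ≥0) (𝓕 : Filtration (FadModel.Horizon T) mΩ)
    (J : ℕ) (θ : Fin J → ℝ) (L : Matrix (Fin J) (Fin J) ℝ)
    (φ ψ γ σ 𝔮 Sm Sp : ℝ) (hφ : 0 ≤ φ) (hψ : 0 ≤ ψ)
    (U : FadModel.Horizon T → Ω → ℝ)
    (hU : FadModel.IsMarkovChain P θ L U) (hU_adapted : Adapted 𝓕 U)
    (Ma Mb : FadModel.Horizon T → Ω → ℕ)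
    (ha : ∀ t, Measurable (Ma t)) (hb : ∀ t, Measurable (Mb t))
    (hMa : FadModel.HasStochasticIntensity P 𝓕 Ma
      (FadModel.modulatedIntensity θ U fun j => FadModel.askRate φ ψ γ σ 𝔮 Sm (θ j)))
    (hMb : FadModel.HasStochasticIntensity P 𝓕 Mb
      (FadModel.modulatedIntensity θ U fun j => FadModel.bidRate φ ψ γ σ 𝔮 Sp (θ j))) :
    (∃ π, FadModel.IsFilter P (FadModel.arrivalFiltration Ma Mb ha hb) θ U π) ∧
    ∀ π, FadModel.IsFilter P (FadModel.arrivalFiltration Ma Mb ha hb) θ U π →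
      (FadModel.HasStochasticIntensity P (FadModel.arrivalFiltration Ma Mb ha hb) Ma
          (FadModel.filteredIntensity π fun j => FadModel.askRate φ ψ γ σ 𝔮 Sm (θ j)) ∧
        Martingale (FadModel.compensated Ma
          (FadModel.filteredIntensity π fun j => FadModel.askRate φ ψ γ σ 𝔮 Sm (θ j)))
          (FadModel.arrivalFiltration Ma Mb ha hb) P) ∧
      (FadModel.HasStochasticIntensity P (FadModel.arrivalFiltration Ma Mb ha hb) Mb
          (FadModel.filteredIntensity π fun j => FadModel.bidRate φ ψ γ σ 𝔮 Sp (θ j)) ∧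
        Martingale (FadModel.compensated Mb
          (FadModel.filteredIntensity π fun j => FadModel.bidRate φ ψ γ σ 𝔮 Sp (θ j)))
          (FadModel.arrivalFiltration Ma Mb ha hb) P) := by
  have hUm : Measurable (Function.uncurry U) :=
    FadModel.measurable_uncurry_of_isProgressive
      (FadModel.isProgressive_of_rightCts hU_adapted hU.rightCts)
  have hle := FadModel.arrivalFiltration_le ha hb hMa.adapted hMb.adapted
  have had := FadModel.adapted_arrivalFiltration ha hb
  refine ⟨FadModel.exists_isFilter hUm ha hb hMa.countingPath hMb.countingPath, fun π hπ => ⟨?_, ?_⟩⟩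
  · exact hMa.filteredIntensity hle hUm (fun t => measurable_fst.comp (had t)) hπ
  · exact hMb.filteredIntensity hle hUm (fun t => measurable_snd.comp (had t)) hπ
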